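/- Let $(W,S)$ be a Coxeter system with length function $\ell$, let $m_{ss'}$ denote the order of $ss'$, and let $T=\bigcup_{w\in W}wSw^{-1}$ be its set of reflections. Fix a geometric representation of $(W,S)$: a real vector space $V$ with a symmetric bilinear form $B$ and a family $\Delta=\{\alpha_s\mid s\in S\}\subseteq V$ which is positively linearly independent (a linear combination of $\Delta$ with non-negative coefficients vanishes only if all coefficients are $0$) and satisfies $B(\alpha_s,\alpha_s)=1$, $B(\alpha_s,\alpha_{s'})=-\cos(\pi/m_{ss'})$ if $m_{ss'}<\infty$, and $B(\alpha_s,\alpha_{s'})\le -1$ if and only if $m_{ss'}=\infty$; the group $W$ acts on $V$ by $s(v)=v-2B(\alpha_s,v)\alpha_s$ for $s\in S$. Let $\Phi=W(\Delta)$ be the root system and $\Phi^+=\Phi\cap\operatorname{cone}(\Delta)$ the set of positive roots. The depth of $\beta\in\Phi^+$ is $\operatorname{dp}(\beta)=\min\{\ell(w)\mid w\in W,\ w(\beta)\in\Delta\}$, and the root poset is $\Phi^+$ ordered by: $\alpha\le\beta$ if and only if there is $w\in W$ with $w(\alpha)=\beta$ and $\ell(w)=\operatorname{dp}(\beta)-\operatorname{dp}(\alpha)$.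 Write $\lhd$ for its cover relation. For $t\in T$, a *$t$-prefix* is an element $p\in W$, $p\ne e$, such that for every reduced word $s_1\cdots s_k s_{k+1}$ for $p$, the palindromic word $s_1\cdots s_k s_{k+1}s_k\cdots s_1$ is a reduced word for $t$. **Proposition.** Let $t\in T$. There is a unique positive root $\alpha_t\in\Phi^+$ such that $t$ acts on $V$ as $v\mapsto v-2B(\alpha_t,v)\alpha_t$, and the following hold. 1. Let $r,s_1,\dots,s_k\in S$ ($k\ge 0$) be such that $\alpha_r\lhd s_k(\alpha_r)\lhd\cdots\lhd s_1\cdots s_{k-1}s_k(\alpha_r)=\alpha_t$ is a saturated chain in $(\Phi^+,\le)$. Then $s_1\cdots s_k r$ is a reduced word, and the element of $W$ that it represents is a $t$-prefix. 2. Let $p_t$ be a $t$-prefix and let $s_1\cdots s_k r$ ($k\ge 0$, $s_1,\dots,s_k,r\in S$) be any reduced word for $p_t$. Then $r$ is the unique right descent of $p_t$, that is, the unique $s\in S$ with $\ell(p_ts)<\ell(p_t)$, and $\alpha_r\lhd s_k(\alpha_r)\lhd\cdots\lhd s_1\cdots s_{k-1}s_k(\alpha_r)=\alpha_t$ is a saturated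 chain in $(\Phi^+,\le)$. -/

import Mathlib

noncomputable section

/-- A simple system `Δ = {α_s | s ∈ S}` for a geometric representation of the Coxeter group with
Coxeter matrix `M`, in the real quadratic space `(V, B)`. The entry `M i j` is the order of
`s_i s_j`, with `M i j = 0` encoding infinite order. -/
structure SimpleSystem {ι : Type*} (M : CoxeterMatrix ι) (V : Type*) [AddCommGroup V]
    [Module ℝ V] where
  /-- the symmetric bilinear form -/
  B : LinearMap.BilinForm ℝ V
  B_symm : ∀ x y : V, B x y = B y x
  /-- the simple roots `α_s` -/
  α : ι → V
  /-- `Δ` is positively linearly independent -/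
  pos_indep : ∀ a : ι →₀ ℝ, (∀ i, 0 ≤ a i) → (a.sum fun i c => c • α i) = 0 → a = 0
  B_of_finite : ∀ i j, M i j ≠ 0 → B (α i) (α j) = -Real.cos (Real.pi / M i j)
  B_le_iff : ∀ i j, B (α i) (α j) ≤ -1 ↔ M i j = 0
  B_self : ∀ i, B (α i) (α i) = 1

namespace SimpleSystem

variable {ι : Type*} {M : CoxeterMatrix ι} {V : Type*} [AddCommGroup V] [Module ℝ V]

theorem two_smul_B_self (D : SimpleSystem M V) (i : ι) : ((2 : ℝ) • D.B (D.α i)) (D.α i) = 2 := by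
  simp [D.B_self]

/-- The reflection `v ↦ v - 2 B(α_i, v) α_i`. -/
def simpleReflection (D : SimpleSystem M V) (i : ι) : V ≃ₗ[ℝ] V :=
  Module.reflection (D.two_smul_B_self i)

theorem simpleReflection_apply (D : SimpleSystem M V) (i : ι) (v : V) :
    D.simpleReflection i v = v - (2 * D.B (D.α i) v) • D.α i := by
  simp [simpleReflection, Module.reflection_apply]

/-- The reflections in the simple roots satisfy the Coxeter relations. -/
theorem isLiftable (D : SimpleSystem M V) : M.IsLiftable D.simpleReflection := by
  intro i j
  by_cases hij : i = j
  · subst hij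
    rw [M.diagonal, pow_one]
    ext v
    exact Module.involutive_reflection (D.two_smul_B_self i) v
  rcases Nat.eq_zero_or_pos (M i j) with h0 | hpos
  · rw [h0, pow_zero]
  have h1 : M i j ≠ 1 := M.off_diagonal i j hij
  have hB := D.B_of_finite i j hpos.ne'
  ext v
  rw [LinearEquiv.coe_one, id]
  by_cases h2 : M i j = 2
  · have hB0 : D.B (D.α i) (D.α j) = 0 := by rw [hB, h2]; simp
    have hB0' : D.B (D.α j) (D.α i) = 0 := by rw [D.B_symm, hB0]
    rw [h2, pow_two]
    simp only [LinearEquiv.mul_apply, simpleReflection_apply, map_sub, map_smul, hB0,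
      hB0', D.B_self]
    module
  set m := M i j with hm
  have hm3 : 3 ≤ m := by omega
  have hmR : (m : ℝ) ≠ 0 := by positivity
  set φ : ℝ := 2 * (Real.pi / m) with hφ
  have hsin : Real.sin φ ≠ 0 := by
    have h3 : (3 : ℝ) ≤ m := by exact_mod_cast hm3
    refine (Real.sin_pos_of_pos_of_lt_pi (by positivity) ?_).ne'
    rw [hφ, ← mul_div_assoc, div_lt_iff₀ (by positivity)]
    nlinarith [Real.pi_pos]
  have ht : 2 * Real.cos φ =
      ((2 : ℝ) • D.B (D.α i)) (D.α j) * ((2 : ℝ) • D.B (D.α j)) (D.α i) - 2 := by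
    simp only [LinearMap.smul_apply, smul_eq_mul, D.B_symm (D.α j) (D.α i), hB, hφ,
      Real.cos_two_mul]
    ring
  have hS (n : ℤ) : (Polynomial.Chebyshev.S ℝ n).eval (2 * Real.cos φ) =
      Real.sin ((n + 1) * φ) / Real.sin φ := by
    rw [eq_div_iff hsin, Polynomial.Chebyshev.S_two_mul_real_cos]
  unfold simpleReflection
  rw [Module.reflection_mul_reflection_pow_apply _ _ m v _ ht]
  rcases Nat.even_or_odd' m with ⟨k, hk | hk⟩
  · have e1 : ((m : ℤ) - 2) / 2 = k - 1 := by omega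
    have e2 : ((m : ℤ) - 1) / 2 = k - 1 := by omega
    have hz : (Polynomial.Chebyshev.S ℝ (k - 1 : ℤ)).eval (2 * Real.cos φ) = 0 := by
      rw [hS]
      have : (((k - 1 : ℤ) : ℝ) + 1) * φ = Real.pi := by
        have : (m : ℝ) = 2 * k := by exact_mod_cast hk
        push_cast
        rw [hφ]
        field_simp
        rw [this]; ring
      rw [this]; simp
    rw [e1, e2, hz]; simp
  · have e1 : ((m : ℤ) - 2) / 2 = k - 1 := by omega
    have e2 : ((m : ℤ) - 1) / 2 = k := by omega
    have e3 : ((m : ℤ) - 3) / 2 = k - 1 := by omega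
    have e4 : (m : ℤ) / 2 = k := by omega
    have hz : (Polynomial.Chebyshev.S ℝ (k : ℤ)).eval (2 * Real.cos φ) +
        (Polynomial.Chebyshev.S ℝ (k - 1 : ℤ)).eval (2 * Real.cos φ) = 0 := by
      rw [hS, hS, ← add_div]
      have : (((k : ℤ) : ℝ) + 1) * φ = 2 * Real.pi - (((k - 1 : ℤ) : ℝ) + 1) * φ := by
        have : (m : ℝ) = 2 * k + 1 := by exact_mod_cast hk
        push_cast
        rw [hφ]
        field_simp
        rw [this]; ring
      rw [this, Real.sin_two_pi_sub]; simp
    rw [e1, e2, e3, e4, hz]; simp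

variable {W : Type*} [Group W] (cs : CoxeterSystem M W) (D : SimpleSystem M V)

/-- The geometric representation: the action of `W` on `V` in which `s` acts as the
reflection `v ↦ v - 2 B(α_s, v) α_s`. -/
def action : W →* (V ≃ₗ[ℝ] V) := cs.lift ⟨D.simpleReflection, D.isLiftable⟩

theorem action_simple (i : ι) (v : V) :
    D.action cs (cs.simple i) v = v - (2 * D.B (D.α i) v) • D.α i := by
  rw [action, cs.lift_apply_simple D.isLiftable, simpleReflection_apply]

/-- The root system `Φ = W(Δ)`. -/
def roots : Set V := {β | ∃ (w : W) (i : ι), D.action cs w (D.α i) = β}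

/-- The set `Φ⁺ = cone(Δ) ∩ Φ` of positive roots, as a type. -/
@[ext]
structure PosRoot where
  /-- the underlying vector -/
  vec : V
  mem_roots : vec ∈ D.roots cs
  mem_cone : vec ∈ PointedCone.hull ℝ (Set.range D.α)

/-- The depth `dp(β) = min {ℓ(w) | w ∈ W, w(β) ∈ Δ}`; the minimum is over a nonempty set whenever
`β` is a root. -/
def depth (β : V) : ℕ :=
  sInf {n | ∃ w : W, D.action cs w β ∈ Set.range D.α ∧ cs.length w = n}

variable {cs D}

theorem exists_depth {β : V} (hβ : β ∈ D.roots cs) :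
    ∃ w : W, D.action cs w β ∈ Set.range D.α ∧ cs.length w = D.depth cs β := by
  obtain ⟨w, i, rfl⟩ := hβ
  refine Nat.sInf_mem (s := {n | ∃ u : W, D.action cs u (D.action cs w (D.α i)) ∈ Set.range D.α ∧
    cs.length u = n}) ⟨_, w⁻¹, ⟨i, ?_⟩, rfl⟩
  rw [← LinearEquiv.mul_apply, ← map_mul, inv_mul_cancel, map_one]
  rfl

theorem depth_action_le {β : V} (hβ : β ∈ D.roots cs) (w : W) :
    D.depth cs (D.action cs w β) ≤ D.depth cs β + cs.length w := by
  obtain ⟨u, hu, hl⟩ := exists_depth hβ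
  have h : D.depth cs (D.action cs w β) ≤ cs.length (u * w⁻¹) := by
    refine Nat.sInf_le ⟨u * w⁻¹, ?_, rfl⟩
    rw [← LinearEquiv.mul_apply, ← map_mul, inv_mul_cancel_right]
    exact hu
  calc _ ≤ _ := h
    _ ≤ cs.length u + cs.length w⁻¹ := cs.length_mul_le _ _
    _ = _ := by rw [hl, cs.length_inv]

/-- The root poset on `Φ⁺`: `α ≤ β` iff there is `w ∈ W` with `w(α) = β` and
`ℓ(w) = dp(β) - dp(α)`. -/
instance rootPoset : PartialOrder (D.PosRoot cs) where
  le a b := ∃ w : W, D.action cs w a.vec = b.vec ∧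
    (cs.length w : ℤ) = (D.depth cs b.vec : ℤ) - (D.depth cs a.vec : ℤ)
  le_refl a := ⟨1, by simp, by simp⟩
  le_trans := by
    rintro a b c ⟨u, hu, hul⟩ ⟨w, hw, hwl⟩
    have h : D.action cs (w * u) a.vec = c.vec := by
      rw [map_mul, LinearEquiv.mul_apply, hu, hw]
    refine ⟨w * u, h, ?_⟩
    have h1 := cs.length_mul_le w u
    have h2 := depth_action_le a.mem_roots (w * u)
    rw [h] at h2
    omega
  le_antisymm := by
    rintro a b ⟨u, hu, hul⟩ ⟨w, hw, hwl⟩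
    have h0 : cs.length u = 0 := by omega
    rw [cs.length_eq_zero_iff] at h0
    subst h0
    ext
    simpa using hu

variable (cs D)

/-- `β` is the positive root `α_t` corresponding to `t`: the element `t` acts on `V` as the
reflection `s_β`. -/
def IsPosRootOf (t : W) (β : D.PosRoot cs) : Prop :=
  ∀ v : V, D.action cs t v = v - (2 * D.B β.vec v) • β.vec

/-- For the word `s_1 ⋯ s_k` given by the list `ω`, the vectors
`α_r, s_k(α_r), …, s_1 ⋯ s_k(α_r) = β` are positive roots that form a saturated chain
`α_r ⋖ s_k(α_r) ⋖ ⋯ ⋖ s_1 ⋯ s_k(α_r) = β` in the root poset. Here `c i = s_{i+1} ⋯ s_k(α_r)`. -/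
def IsSaturatedChain (ω : List ι) (r : ι) (β : D.PosRoot cs) : Prop :=
  ∃ c : Fin (ω.length + 1) → D.PosRoot cs,
    (∀ i, (c i).vec = D.action cs (cs.wordProd (ω.drop i)) (D.α r)) ∧
    (∀ i : Fin ω.length, c i.succ ⋖ c i.castSucc) ∧
    c 0 = β

end SimpleSystem

/-- `p` is a `t`-prefix: `p ≠ 1`, and for every reduced word `s_1 ⋯ s_k r` for `p` the palindromic
word `s_1 ⋯ s_k r s_k ⋯ s_1` is a reduced word for `t`. -/
def CoxeterSystem.IsReflectionPrefix {ι W : Type*} [Group W] {M : CoxeterMatrix ι}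
    (cs : CoxeterSystem M W) (t p : W) : Prop :=
  p ≠ 1 ∧ ∀ (ω : List ι) (r : ι), cs.IsReduced (ω ++ [r]) → cs.wordProd (ω ++ [r]) = p →
    cs.IsReduced (ω ++ [r] ++ ω.reverse) ∧ cs.wordProd (ω ++ [r] ++ ω.reverse) = t

end

/-! Everything reduces to the length formula `ℓ(t) = 2 dp(α_t) + 1` (`IsPosRootOf.length_eq`): a
palindrome `ω r ω⁻¹` representing `t` is reduced exactly when `dp(α_t) = |ω|`. Along a saturated
chain the depth grows at each of the `|ω|` steps, and it is at most `|ω|`; so equality holds and the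
palindrome is reduced. Conversely, if `ω(α_r) = α_t` has depth `|ω|`, each letter must raise the
depth by exactly one, and every step is a cover. The prefix property concerns all reduced words `ω'
r'` of the same element. If `r' ≠ r`, then `ω'⁻¹(α_t) = -s_{r'}(α_r)` is negative; but an element
making `α_t` negative is longer than its depth (`depth_lt_length_of_neg_mem`), and `ω'` is not. So
`r' = r` (`eq_of_wordProd_eq`), which also gives the unique descent. These arguments rest on the
positive/negative dichotomy for roots and on faithfulness of the representation, both derived from
`action_alpha_mem_posCone`. -/

namespace SimpleSystem

open Polynomial (Chebyshev.U)

variable {ι : Type*} {M : CoxeterMatrix ι} {V : Type*} [AddCommGroup V] [Module ℝ V]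

/-- The cone spanned by the simple roots. -/
abbrev posCone (D : SimpleSystem M V) : PointedCone ℝ V := PointedCone.hull ℝ (Set.range D.α)

variable {W : Type*} [Group W] (cs : CoxeterSystem M W) (D : SimpleSystem M V)

/-! ### The cone over a positively independent family -/

section Cone

theorem alpha_mem_posCone (i : ι) : D.α i ∈ D.posCone := PointedCone.subset_hull ⟨i, rfl⟩

theorem smul_mem_posCone {c : ℝ} (hc : 0 ≤ c) {v : V} (hv : v ∈ D.posCone) :
    c • v ∈ D.posCone :=
  D.posCone.smul_mem hc hv

theorem exists_nonneg_linearCombination {v : V} (hv : v ∈ D.posCone) :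
    ∃ a : ι →₀ ℝ, (∀ i, 0 ≤ a i) ∧ Finsupp.linearCombination ℝ D.α a = v := by
  induction hv using Submodule.span_induction with
  | mem v hv =>
    classical
    obtain ⟨i, rfl⟩ := hv
    refine ⟨Finsupp.single i 1, fun j => ?_, by simp⟩
    rw [Finsupp.single_apply]
    split_ifs <;> norm_num
  | zero => exact ⟨0, fun i => le_rfl, map_zero _⟩
  | add u v _ _ hu hv =>
    obtain ⟨a, ha, rfl⟩ := hu
    obtain ⟨b, hb, rfl⟩ := hv
    exact ⟨a + b, fun i => add_nonneg (ha i) (hb i), map_add _ _ _⟩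
  | smul c v _ hv =>
    obtain ⟨a, ha, rfl⟩ := hv
    exact ⟨(c : ℝ) • a, fun i => mul_nonneg c.2 (ha i), map_smul _ _ _⟩

theorem eq_zero_of_linearCombination_eq_zero {a : ι →₀ ℝ} (ha : ∀ i, 0 ≤ a i)
    (h : Finsupp.linearCombination ℝ D.α a = 0) : a = 0 :=
  D.pos_indep a ha (by rwa [Finsupp.linearCombination_apply] at h)

theorem eq_zero_of_mem_posCone_of_neg_mem {v : V} (hv : v ∈ D.posCone) (hv' : -v ∈ D.posCone) :
    v = 0 := by
  obtain ⟨a, ha, hav⟩ := D.exists_nonneg_linearCombination hv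
  obtain ⟨b, hb, hbv⟩ := D.exists_nonneg_linearCombination hv'
  have hab : a + b = 0 := D.eq_zero_of_linearCombination_eq_zero
    (fun i => add_nonneg (ha i) (hb i)) (by rw [map_add, hav, hbv, add_neg_cancel])
  have ha0 : a = 0 := by
    ext i
    have := DFunLike.congr_fun hab i
    simp only [Finsupp.add_apply, Finsupp.zero_apply] at this
    linarith [ha i, hb i, show (0 : ι →₀ ℝ) i = 0 from rfl]
  rw [← hav, ha0, map_zero]

theorem B_alpha_nonpos {i j : ι} (hij : i ≠ j) : D.B (D.α i) (D.α j) ≤ 0 := by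
  by_cases h : M i j = 0
  · linarith [(D.B_le_iff i j).2 h]
  · have h1 := M.off_diagonal i j hij
    have h2 : (2 : ℝ) ≤ M i j := by exact_mod_cast (by omega : 2 ≤ M i j)
    have hπ := Real.pi_pos
    rw [D.B_of_finite i j h, neg_nonpos]
    refine Real.cos_nonneg_of_neg_pi_div_two_le_of_le ?_ ?_
    · have : 0 ≤ Real.pi / M i j := by positivity
      linarith
    · gcongr

/-- If subtracting a multiple of `α_i` turns an element of the cone into an element of the
opposite cone, then this element is a multiple of `α_i`. -/
theorem exists_eq_smul_alpha {i : ι} {v : V} {k : ℝ} (hv : v ∈ D.posCone)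
    (hv' : -(v - k • D.α i) ∈ D.posCone) : ∃ b : ℝ, v = b • D.α i := by
  classical
  obtain ⟨a, ha, hav⟩ := D.exists_nonneg_linearCombination hv
  obtain ⟨g, hg, hgv⟩ := D.exists_nonneg_linearCombination hv'
  set c := a + g with hc
  have hc0 (j : ι) : 0 ≤ c j := add_nonneg (ha j) (hg j)
  have hcv : Finsupp.linearCombination ℝ D.α c = k • D.α i := by
    rw [hc, map_add, hav, hgv]; abel
  have hcz (j : ι) (hj : j ≠ i) : c j = 0 := by
    -- Coefficients of `∑ c_j α_j = k α_i` cannot be compared directly, as `Δ` may be linearly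
    -- dependent. If `k ≤ c_i`, positive independence applies to the difference; otherwise pairing
    -- `∑_{j≠i} c_j α_j = (k - c_i) α_i` with `α_i` gives a value both `≤ 0` and `> 0`.
    rcases le_or_gt k (c i) with hk | hk
    · have h0 : c - Finsupp.single i k = 0 := by
        refine D.eq_zero_of_linearCombination_eq_zero (fun l => ?_) ?_
        · by_cases hl : l = i
          · subst hl; simpa using hk
          · simpa [Finsupp.single_apply, Ne.symm hl] using hc0 l
        · rw [map_sub, hcv, Finsupp.linearCombination_single, sub_self]
      have := DFunLike.congr_fun h0 j
      simpa [Finsupp.single_apply, Ne.symm hj] using this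
    · exfalso
      have he : Finsupp.linearCombination ℝ D.α (c.erase i) = (k - c i) • D.α i := by
        rw [Finsupp.erase_eq_sub_single, map_sub, hcv, Finsupp.linearCombination_single, sub_smul]
      have hB := congrArg (D.B (D.α i)) he
      rw [Finsupp.linearCombination_apply, Finsupp.sum, map_sum, map_smul, D.B_self] at hB
      have : ∑ j ∈ (c.erase i).support, D.B (D.α i) ((c.erase i) j • D.α j) ≤ 0 := by
        refine Finset.sum_nonpos fun j hj => ?_
        rw [Finsupp.support_erase, Finset.mem_erase] at hj
        rw [map_smul, smul_eq_mul, Finsupp.erase_ne hj.1]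
        exact mul_nonpos_of_nonneg_of_nonpos (hc0 j) (D.B_alpha_nonpos hj.1.symm)
      rw [hB, smul_eq_mul] at this
      linarith
  refine ⟨a i, ?_⟩
  have : a = Finsupp.single i (a i) := by
    ext j
    by_cases hj : j = i
    · subst hj; simp
    · have := hcz j hj
      rw [hc, Finsupp.add_apply] at this
      rw [Finsupp.single_apply, if_neg (Ne.symm hj)]
      linarith [ha j, hg j]
  rw [← hav, this, Finsupp.linearCombination_single, Finsupp.single_eq_same]

end Cone

/-! ### Invariance of the form and elementary facts on roots -/

section Action

theorem action_mul_apply (u w : W) (v : V) :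
    D.action cs (u * w) v = D.action cs u (D.action cs w v) := by
  rw [map_mul, LinearEquiv.mul_apply]

theorem action_one_apply (v : V) : D.action cs 1 v = v := by
  rw [map_one, LinearEquiv.coe_one, id]

theorem action_simple_self (i : ι) : D.action cs (cs.simple i) (D.α i) = -D.α i := by
  rw [action_simple, D.B_self]; module

theorem action_simple_simple (i : ι) (v : V) :
    D.action cs (cs.simple i) (D.action cs (cs.simple i) v) = v := by
  rw [← action_mul_apply, cs.simple_mul_simple_self, action_one_apply]

theorem B_action (w : W) (x y : V) : D.B (D.action cs w x) (D.action cs w y) = D.B x y := by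
  induction w using cs.simple_induction_left generalizing x y with
  | one => simp
  | mul_simple_left w i ih =>
    rw [action_mul_apply, action_mul_apply, ← ih x y]
    simp only [action_simple, map_sub, map_smul, LinearMap.sub_apply, LinearMap.smul_apply,
      D.B_self, D.B_symm _ (D.α i), smul_eq_mul]
    ring

variable {cs D}

theorem action_mem_roots {β : V} (hβ : β ∈ D.roots cs) (w : W) :
    D.action cs w β ∈ D.roots cs := by
  obtain ⟨u, i, rfl⟩ := hβ
  exact ⟨w * u, i, action_mul_apply cs D w u _⟩

theorem neg_mem_roots {β : V} (hβ : β ∈ D.roots cs) : -β ∈ D.roots cs := by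
  obtain ⟨u, i, rfl⟩ := hβ
  exact ⟨u * cs.simple i, i, by rw [action_mul_apply, action_simple_self, map_neg]⟩

theorem B_root {β : V} (hβ : β ∈ D.roots cs) : D.B β β = 1 := by
  obtain ⟨u, i, rfl⟩ := hβ
  rw [B_action, D.B_self]

theorem root_ne_zero {β : V} (hβ : β ∈ D.roots cs) : β ≠ 0 := by
  rintro rfl
  simpa using B_root hβ

variable (cs D) in
theorem alpha_mem_roots (i : ι) : D.α i ∈ D.roots cs := ⟨1, i, action_one_apply cs D _⟩

theorem neg_notMem_posCone {β : V} (hβ : β ∈ D.roots cs) (h : β ∈ D.posCone) :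
    -β ∉ D.posCone :=
  fun h' => root_ne_zero hβ (D.eq_zero_of_mem_posCone_of_neg_mem h h')

end Action

/-! ### Roots in rank two via Chebyshev polynomials -/

section Dihedral

/-- With `c = -B(α_s, α_t)`, applying one more reflection is the recursion `U_{n+1} = 2c U_n -
U_{n-1}` on the coefficients. -/
theorem action_alternatingWord (s t : ι) (n : ℕ) :
    D.action cs (cs.wordProd (CoxeterSystem.alternatingWord s t n)) (D.α s) =
      if Even n then (Chebyshev.U ℝ n).eval (-D.B (D.α s) (D.α t)) • D.α s +
          (Chebyshev.U ℝ (n - 1)).eval (-D.B (D.α s) (D.α t)) • D.α t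
        else (Chebyshev.U ℝ (n - 1)).eval (-D.B (D.α s) (D.α t)) • D.α s +
          (Chebyshev.U ℝ n).eval (-D.B (D.α s) (D.α t)) • D.α t := by
  induction n with
  | zero => simp [CoxeterSystem.alternatingWord]
  | succ n ih =>
    rw [CoxeterSystem.alternatingWord_succ', cs.wordProd_cons, action_mul_apply, ih]
    push_cast
    rw [Polynomial.Chebyshev.U_add_one, add_sub_cancel_right]
    by_cases hn : Even n
    · simp only [hn, if_true, Nat.even_add_one, not_true_eq_false, if_false, action_simple,
        map_add, map_smul, D.B_self, D.B_symm (D.α t) (D.α s), Polynomial.eval_sub,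
        Polynomial.eval_mul, Polynomial.eval_X, Polynomial.eval_ofNat]
      module
    · simp only [hn, if_false, Nat.even_add_one, not_false_eq_true, if_true, action_simple,
        map_add, map_smul, D.B_self, Polynomial.eval_sub,
        Polynomial.eval_mul, Polynomial.eval_X, Polynomial.eval_ofNat]
      module

theorem eval_U_nonneg_of_one_le {c : ℝ} (hc : 1 ≤ c) (n : ℕ) :
    0 ≤ (Chebyshev.U ℝ (n - 1)).eval c ∧
      (Chebyshev.U ℝ (n - 1)).eval c ≤ (Chebyshev.U ℝ n).eval c := by
  induction n with
  | zero => simp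
  | succ n ih =>
    push_cast
    rw [Polynomial.Chebyshev.U_add_one, add_sub_cancel_right]
    simp only [Polynomial.eval_sub, Polynomial.eval_mul, Polynomial.eval_X,
      Polynomial.eval_ofNat]
    constructor
    · linarith
    · nlinarith

/-- For finite `m`, put `θ = π/m`: `U_{n-1}(cos θ) sin θ = sin nθ ≥ 0` since `nθ ≤ π`. For infinite
order the argument is at least `1`, where the `U_n` increase. -/
theorem eval_U_nonneg {s t : ι} (hst : s ≠ t) {n : ℕ} (hn : M s t ≠ 0 → n ≤ M s t) :
    0 ≤ (Chebyshev.U ℝ (n - 1)).eval (-D.B (D.α s) (D.α t)) := by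
  by_cases h0 : M s t = 0
  · exact (eval_U_nonneg_of_one_le (by linarith [(D.B_le_iff s t).2 h0]) n).1
  have hm : 2 ≤ M s t := by have := M.off_diagonal s t hst; omega
  have hmR : (2 : ℝ) ≤ M s t := by exact_mod_cast hm
  have hnR : (n : ℝ) ≤ M s t := by exact_mod_cast hn h0
  have hπ := Real.pi_pos
  rw [D.B_of_finite s t h0, neg_neg]
  have h := Polynomial.Chebyshev.U_real_cos (Real.pi / M s t) ((n : ℤ) - 1)
  have hsin : 0 < Real.sin (Real.pi / M s t) := by
    refine Real.sin_pos_of_pos_of_lt_pi (by positivity) ?_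
    rw [div_lt_iff₀ (by positivity)]
    nlinarith
  refine nonneg_of_mul_nonneg_left ?_ hsin
  rw [h]
  push_cast
  rw [sub_add_cancel]
  refine Real.sin_nonneg_of_nonneg_of_le_pi (by positivity) ?_
  rw [mul_div_assoc', div_le_iff₀ (by positivity)]
  nlinarith

/-- The root `(⋯ s t)(α_s)` is a non-negative combination of `α_s` and `α_t`, if the alternating
word is short enough. -/
theorem exists_action_alternatingWord {s t : ι} (hst : s ≠ t) {n : ℕ}
    (hn : M s t ≠ 0 → n < M s t) :
    ∃ a b : ℝ, 0 ≤ a ∧ 0 ≤ b ∧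
      D.action cs (cs.wordProd (CoxeterSystem.alternatingWord s t n)) (D.α s) =
        a • D.α s + b • D.α t := by
  have h1 := D.eval_U_nonneg hst (n := n) fun h => (hn h).le
  have h2 := D.eval_U_nonneg hst (n := n + 1) hn
  push_cast at h2
  rw [add_sub_cancel_right] at h2
  rw [action_alternatingWord]
  split_ifs
  · exact ⟨_, _, h2, h1, rfl⟩
  · exact ⟨_, _, h1, h2, rfl⟩

end Dihedral

/-! ### Descents and signs of roots; faithfulness -/

section Positivity

/-- Every `w` is a length-additive product of an element `v` without right descents in `{s, t}`
and an alternating word. -/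
theorem _root_.CoxeterSystem.exists_eq_mul_alternatingWord (s t : ι) (v : W) (n : ℕ)
    (h : cs.length (v * cs.wordProd (CoxeterSystem.alternatingWord s t n)) =
      cs.length v + n) :
    ∃ (u : W) (m : ℕ), n ≤ m ∧
      v * cs.wordProd (CoxeterSystem.alternatingWord s t n) =
        u * cs.wordProd (CoxeterSystem.alternatingWord s t m) ∧
      cs.length (v * cs.wordProd (CoxeterSystem.alternatingWord s t n)) = cs.length u + m ∧
      ¬ cs.IsRightDescent u (if Even m then t else s) := by
  induction hl : cs.length v generalizing v n with
  | zero =>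
    refine ⟨v, n, le_rfl, rfl, h, ?_⟩
    unfold CoxeterSystem.IsRightDescent
    omega
  | succ l ih =>
    by_cases hd : cs.IsRightDescent v (if Even n then t else s)
    · rw [cs.isRightDescent_iff] at hd
      set x := if Even n then t else s with hx
      have he : v * cs.simple x *
          cs.wordProd (CoxeterSystem.alternatingWord s t (n + 1)) =
          v * cs.wordProd (CoxeterSystem.alternatingWord s t n) := by
        rw [CoxeterSystem.alternatingWord_succ', cs.wordProd_cons, ← hx, mul_assoc v,
          cs.simple_mul_simple_cancel_left]
      obtain ⟨u, m, h1, h2, h3, h4⟩ := ih (v * cs.simple x) (n + 1) (by rw [he]; omega) (by omega)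
      rw [he] at h2 h3
      exact ⟨u, m, by omega, h2, h3, h4⟩
    · exact ⟨v, n, le_rfl, rfl, h, hd⟩

/-- Split off from `w` a maximal alternating word in `s` and another letter `t`, a right descent of
`w`. It sends `α_s` to a non-negative combination of `α_s` and `α_t`, and the remaining shorter
factor `u` keeps both positive by induction. -/
theorem action_alpha_mem_posCone {w : W} {s : ι} (h : ¬ cs.IsRightDescent w s) :
    D.action cs w (D.α s) ∈ D.posCone := by
  induction hl : cs.length w using Nat.strong_induction_on generalizing w s with
  | _ l ih =>
  subst hl
  by_cases hw : w = 1
  · subst hw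
    rw [action_one_apply]
    exact D.alpha_mem_posCone s
  obtain ⟨t, ht⟩ := cs.exists_rightDescent_of_ne_one hw
  have hst : s ≠ t := by rintro rfl; exact h ht
  rw [cs.isRightDescent_iff] at ht
  have h1 : w * cs.simple t * cs.wordProd (CoxeterSystem.alternatingWord s t 1) = w := by
    simp [CoxeterSystem.alternatingWord]
  obtain ⟨u, m, hm, hu, hlu, hd⟩ :=
    cs.exists_eq_mul_alternatingWord s t (w * cs.simple t) 1 (by rw [h1]; omega)
  rw [h1] at hu hlu
  obtain ⟨k, rfl⟩ : ∃ k, m = k + 1 := ⟨m - 1, by omega⟩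
  -- This is the first letter of the alternating word; were it a descent of `u`, cancelling it would
  -- make `w` too short.
  have hd' : ¬ cs.IsRightDescent u (if Even k then t else s) := by
    intro hd'
    rw [cs.isRightDescent_iff] at hd'
    have h2 := cs.length_mul_le (u * cs.simple (if Even k then t else s))
      (cs.wordProd (CoxeterSystem.alternatingWord s t k))
    have h3 := cs.length_wordProd_le (CoxeterSystem.alternatingWord s t k)
    rw [CoxeterSystem.length_alternatingWord] at h3
    rw [CoxeterSystem.alternatingWord_succ', cs.wordProd_cons, ← mul_assoc] at hu
    rw [← hu] at h2
    omega
  have hdd : ¬ cs.IsRightDescent u s ∧ ¬ cs.IsRightDescent u t := by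
    by_cases hk : Even k <;> simp only [hk, Nat.even_add_one, not_true_eq_false,
      not_false_eq_true, if_true, if_false] at hd hd' <;> exact ⟨‹_›, ‹_›⟩
  -- Otherwise the alternating word followed by `s` has length `k + 2 > m` and is not reduced, so
  -- `s` would be a descent of `w`.
  have hmM : M s t ≠ 0 → k + 1 < M s t := by
    intro h0
    by_contra hlt
    rw [M.symmetric s t] at h0 hlt
    have h2 := cs.not_isReduced_alternatingWord t s h0 (m := k + 2) (by omega)
    have h3 := cs.length_wordProd_le (CoxeterSystem.alternatingWord t s (k + 2))
    rw [CoxeterSystem.IsReduced, CoxeterSystem.length_alternatingWord] at h2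
    rw [CoxeterSystem.length_alternatingWord] at h3
    have h4 := cs.length_mul_le u (cs.wordProd (CoxeterSystem.alternatingWord t s (k + 2)))
    rw [CoxeterSystem.alternatingWord_succ t s, cs.wordProd_concat] at h2 h3 h4
    rw [← mul_assoc, ← hu] at h4
    rw [cs.not_isRightDescent_iff] at h
    omega
  obtain ⟨a, b, ha, hb, hab⟩ := exists_action_alternatingWord cs D hst hmM
  rw [hu, action_mul_apply, hab, map_add, map_smul, map_smul]
  exact add_mem (D.smul_mem_posCone ha (ih _ (by omega) hdd.1 rfl))
    (D.smul_mem_posCone hb (ih _ (by omega) hdd.2 rfl))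

theorem neg_action_alpha_mem_posCone {w : W} {s : ι} (h : cs.IsRightDescent w s) :
    -D.action cs w (D.α s) ∈ D.posCone := by
  rw [← map_neg, ← action_simple_self cs, ← action_mul_apply]
  exact action_alpha_mem_posCone cs D ((cs.isRightDescent_iff_not_isRightDescent_mul).1 h)

theorem isRightDescent_iff_neg_mem {w : W} {s : ι} :
    cs.IsRightDescent w s ↔ -D.action cs w (D.α s) ∈ D.posCone := by
  refine ⟨neg_action_alpha_mem_posCone cs D, fun h => ?_⟩
  by_contra hd
  exact neg_notMem_posCone (action_mem_roots (alpha_mem_roots cs D s) w)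
    (action_alpha_mem_posCone cs D hd) h

theorem mem_posCone_or_neg_mem {β : V} (hβ : β ∈ D.roots cs) :
    β ∈ D.posCone ∨ -β ∈ D.posCone := by
  obtain ⟨w, i, rfl⟩ := hβ
  by_cases h : cs.IsRightDescent w i
  · exact Or.inr (neg_action_alpha_mem_posCone cs D h)
  · exact Or.inl (action_alpha_mem_posCone cs D h)

theorem action_injective : Function.Injective (D.action cs) := by
  rw [injective_iff_map_eq_one]
  intro w hw
  by_contra hne
  obtain ⟨s, hs⟩ := cs.exists_rightDescent_of_ne_one hne
  rw [isRightDescent_iff_neg_mem cs D, hw] at hs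
  exact neg_notMem_posCone (alpha_mem_roots cs D s) (D.alpha_mem_posCone s) hs

variable {cs D}

/-- Positive roots proportional to a positive root are equal to it. -/
theorem eq_of_eq_smul {β γ : V} (hβ : β ∈ D.roots cs) (hγ : γ ∈ D.roots cs)
    (hβ' : β ∈ D.posCone) (hγ' : γ ∈ D.posCone) {c : ℝ} (h : γ = c • β) : γ = β := by
  have h1 := B_root hγ
  rw [h] at h1
  simp only [map_smul, LinearMap.smul_apply, smul_eq_mul, B_root hβ, mul_one] at h1
  rcases mul_self_eq_one_iff.1 h1 with rfl | rfl
  · rw [h, one_smul]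
  · refine absurd ?_ (neg_notMem_posCone hγ hγ')
    rwa [h, neg_one_smul, neg_neg]

/-- The simple reflection `s_i` permutes the positive roots other than `α_i`. -/
theorem action_simple_mem_posCone {β : V} (hβ : β ∈ D.roots cs) (hβ' : β ∈ D.posCone) {i : ι}
    (hi : β ≠ D.α i) : D.action cs (cs.simple i) β ∈ D.posCone := by
  refine (mem_posCone_or_neg_mem cs D (action_mem_roots hβ _)).resolve_right fun h => hi ?_
  rw [action_simple] at h
  obtain ⟨b, hb⟩ := D.exists_eq_smul_alpha hβ' h
  exact eq_of_eq_smul (alpha_mem_roots cs D i) hβ (D.alpha_mem_posCone i) hβ' hb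

end Positivity

end SimpleSystem

namespace SimpleSystem

variable {ι : Type*} {M : CoxeterMatrix ι} {V : Type*} [AddCommGroup V] [Module ℝ V]
variable {W : Type*} [Group W] {cs : CoxeterSystem M W} {D : SimpleSystem M V}

/-! ### Depth versus length -/

section Depth

theorem depth_le_of_action_eq {β : V} {w : W} {r : ι} (h : D.action cs w (D.α r) = β) :
    D.depth cs β ≤ cs.length w := by
  refine Nat.sInf_le ⟨w⁻¹, ⟨r, ?_⟩, cs.length_inv w⟩
  rw [← h, ← action_mul_apply, inv_mul_cancel, action_one_apply]

theorem depth_alpha (i : ι) : D.depth cs (D.α i) = 0 :=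
  Nat.le_zero.1 ((depth_le_of_action_eq (action_one_apply cs D (D.α i))).trans_eq cs.length_one)

theorem depth_le_depth_action_simple_add_one {β : V} (hβ : β ∈ D.roots cs) (i : ι) :
    D.depth cs β ≤ D.depth cs (D.action cs (cs.simple i) β) + 1 := by
  have h := depth_action_le (action_mem_roots hβ (cs.simple i)) (cs.simple i)
  rwa [action_simple_simple, cs.length_simple] at h

/-- An element which makes a positive root negative is longer than the depth of this root. -/
theorem depth_lt_length_of_neg_mem {β : V} (hβ : β ∈ D.roots cs) (hβ' : β ∈ D.posCone) {w : W}
    (h : -D.action cs w β ∈ D.posCone) : D.depth cs β < cs.length w := by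
  induction hl : cs.length w generalizing w β with
  | zero =>
    rw [cs.length_eq_zero_iff] at hl
    rw [hl, action_one_apply] at h
    exact absurd h (neg_notMem_posCone hβ hβ')
  | succ l ih =>
    obtain ⟨i, hi⟩ := cs.exists_rightDescent_of_ne_one (w := w)
      (by rintro rfl; simp at hl)
    rw [cs.isRightDescent_iff] at hi
    -- Off `α_i`, the root `s_i(β)` stays positive and the shorter `w s_i` makes it negative; its
    -- depth is at least `dp(β) - 1`.
    by_cases hne : β = D.α i
    · rw [hne, depth_alpha]
      omega
    · have := ih (w := w * cs.simple i) (action_mem_roots hβ (cs.simple i))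
        (action_simple_mem_posCone hβ hβ' hne)
        (by rwa [action_mul_apply, action_simple_simple]) (by omega)
      have := depth_le_depth_action_simple_add_one hβ i
      omega

end Depth

/-! ### Reflections, their positive roots and their lengths -/

section Reflection

theorem action_conj_of_reflection {t w : W} {β : V}
    (h : ∀ v, D.action cs t v = v - (2 * D.B β v) • β) (v : V) :
    D.action cs (w * t * w⁻¹) v =
      v - (2 * D.B (D.action cs w β) v) • D.action cs w β := by
  have hv : D.action cs w (D.action cs w⁻¹ v) = v := by
    rw [← action_mul_apply, mul_inv_cancel, action_one_apply]
  rw [action_mul_apply, action_mul_apply, h, map_sub, map_smul, hv]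
  conv_rhs => rw [← hv, B_action, hv]

theorem IsPosRootOf.unique {t : W} {β γ : D.PosRoot cs} (hβ : D.IsPosRootOf cs t β)
    (hγ : D.IsPosRootOf cs t γ) : γ = β := by
  have h := hβ γ.vec
  rw [hγ γ.vec, B_root γ.mem_roots] at h
  refine PosRoot.ext (eq_of_eq_smul β.mem_roots γ.mem_roots β.mem_cone γ.mem_cone
    (c := D.B β.vec γ.vec) ?_)
  have h2 : (2 : ℝ) • γ.vec = (2 : ℝ) • (D.B β.vec γ.vec • β.vec) := by
    rw [smul_smul]
    have h3 := sub_right_injective h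
    simpa using h3
  exact smul_right_injective V (two_ne_zero : (2 : ℝ) ≠ 0) h2

variable (D) in
theorem exists_isPosRootOf {t : W} (ht : cs.IsReflection t) :
    ∃ β : D.PosRoot cs, D.IsPosRootOf cs t β := by
  obtain ⟨w, i, rfl⟩ := ht
  have h := action_conj_of_reflection (w := w) (D.action_simple cs i)
  have hr : D.action cs w (D.α i) ∈ D.roots cs := ⟨w, i, rfl⟩
  rcases mem_posCone_or_neg_mem cs D hr with hp | hp
  · exact ⟨⟨_, hr, hp⟩, h⟩
  · refine ⟨⟨_, neg_mem_roots hr, hp⟩, fun v => ?_⟩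
    rw [h]
    simp

theorem IsPosRootOf.conj {t : W} {β γ : D.PosRoot cs} (h : D.IsPosRootOf cs t β) {w : W}
    (hw : D.action cs w β.vec = γ.vec) : D.IsPosRootOf cs (w * t * w⁻¹) γ :=
  fun v => by rw [action_conj_of_reflection h, hw]

/-- An element of `W` acting as a reflection in the root `w(α_r)` is `w s_r w⁻¹`. -/
theorem IsPosRootOf.eq_conj {t : W} {β : D.PosRoot cs} (h : D.IsPosRootOf cs t β) {w : W} {r : ι}
    (hw : D.action cs w (D.α r) = β.vec) : t = w * cs.simple r * w⁻¹ := by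
  refine action_injective cs D (LinearEquiv.ext fun v => ?_)
  rw [h v, action_conj_of_reflection (D.action_simple cs r), hw]

theorem IsPosRootOf.action_self {t : W} {β : D.PosRoot cs} (h : D.IsPosRootOf cs t β) :
    D.action cs t β.vec = -β.vec := by
  rw [h, B_root β.mem_roots]; module

/-- An element `u` realising the depth writes `t` as `u⁻¹ s_j u`. -/
theorem IsPosRootOf.length_le {t : W} {β : D.PosRoot cs} (h : D.IsPosRootOf cs t β) :
    cs.length t ≤ 2 * D.depth cs β.vec + 1 := by
  obtain ⟨u, ⟨j, hj⟩, hu⟩ := exists_depth β.mem_roots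
  have ht := h.eq_conj (w := u⁻¹) (r := j)
    (by rw [hj, ← action_mul_apply, inv_mul_cancel, action_one_apply])
  have h1 := cs.length_mul_le (u⁻¹ * cs.simple j) u⁻¹⁻¹
  have h2 := cs.length_mul_le u⁻¹ (cs.simple j)
  rw [← ht] at h1
  simp only [cs.length_inv, cs.length_simple] at h1 h2
  omega

/-- Conjugating `t` by a descent `s_i` with `α_i ≠ β` shortens it by two, while the depth of its
root drops by at most one. -/
theorem IsPosRootOf.le_length {t : W} {β : D.PosRoot cs} (h : D.IsPosRootOf cs t β) :
    2 * D.depth cs β.vec + 1 ≤ cs.length t := by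
  induction hl : cs.length t using Nat.strong_induction_on generalizing t β with
  | _ l ih =>
  have ht1 : t ≠ 1 := by
    rintro rfl
    have := h.action_self
    rw [action_one_apply] at this
    exact neg_notMem_posCone β.mem_roots β.mem_cone (this ▸ β.mem_cone)
  have hpos : 0 < cs.length t := Nat.pos_of_ne_zero (mt cs.length_eq_zero_iff.1 ht1)
  obtain ⟨i, hi⟩ := cs.exists_rightDescent_of_ne_one ht1
  by_cases hβ : β.vec = D.α i
  · rw [hβ, depth_alpha]
    omega
  have hneg := neg_action_alpha_mem_posCone cs D hi
  have hroot : -D.action cs t (D.α i) ∈ D.roots cs :=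
    neg_mem_roots (action_mem_roots (alpha_mem_roots cs D i) t)
  -- Only multiples of `β` are negated by `t`, and the only positive root among them is `β`.
  have hne : -D.action cs t (D.α i) ≠ D.α i := by
    intro he
    rw [h] at he
    refine hβ (eq_of_eq_smul (alpha_mem_roots cs D i) β.mem_roots (D.alpha_mem_posCone i)
      β.mem_cone (c := (D.B β.vec (D.α i))⁻¹) ?_)
    have h2 : D.α i = D.B β.vec (D.α i) • β.vec := by
      refine smul_right_injective V (two_ne_zero : (2 : ℝ) ≠ 0) ?_
      dsimp only
      rw [smul_smul]
      conv_lhs => rw [two_smul]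
      nth_rewrite 1 [← he]
      module
    have h3 : D.B β.vec (D.α i) ≠ 0 := by
      intro h0
      rw [h0, zero_smul] at h2
      exact root_ne_zero (alpha_mem_roots cs D i) h2
    rw [h2, smul_smul, ← h2, inv_mul_cancel₀ h3, one_smul]
  have hd : cs.IsRightDescent t⁻¹ i := by
    have : t⁻¹ = t := by
      refine inv_eq_of_mul_eq_one_right (action_injective cs D (LinearEquiv.ext fun v => ?_))
      rw [action_mul_apply, h, h, map_one]
      simp only [map_sub, map_smul, B_root β.mem_roots, smul_eq_mul, LinearEquiv.coe_one, id]
      module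
    rwa [this]
  rw [cs.isRightDescent_inv_iff, cs.isLeftDescent_iff] at hd
  -- The positive root `-t(α_i)` differs from `α_i`, so `s_i` keeps it positive.
  have hd2 : cs.IsRightDescent (cs.simple i * t) i := by
    rw [isRightDescent_iff_neg_mem cs D, action_mul_apply, ← map_neg]
    exact action_simple_mem_posCone hroot hneg hne
  rw [cs.isRightDescent_iff] at hd2
  let γ : D.PosRoot cs := ⟨D.action cs (cs.simple i) β.vec, action_mem_roots β.mem_roots _,
    action_simple_mem_posCone β.mem_roots β.mem_cone hβ⟩
  have hγ : D.IsPosRootOf cs (cs.simple i * t * cs.simple i) γ := by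
    have := h.conj (w := cs.simple i) (γ := γ) rfl
    rwa [cs.inv_simple] at this
  have h1 := ih _ (by omega) hγ rfl
  have h2 : D.depth cs β.vec ≤ D.depth cs γ.vec + 1 :=
    depth_le_depth_action_simple_add_one β.mem_roots i
  omega

/-- A reflection `t` has length `2 dp(α_t) + 1`. -/
theorem IsPosRootOf.length_eq {t : W} {β : D.PosRoot cs} (h : D.IsPosRootOf cs t β) :
    cs.length t = 2 * D.depth cs β.vec + 1 :=
  le_antisymm h.length_le h.le_length

end Reflection

/-! ### Covers and saturated chains -/

section Poset

theorem depth_lt_depth_of_lt {a b : D.PosRoot cs} (h : a < b) :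
    D.depth cs a.vec < D.depth cs b.vec := by
  obtain ⟨w, hw, hl⟩ := h.le
  have : cs.length w ≠ 0 := by
    rw [Ne, cs.length_eq_zero_iff]
    rintro rfl
    rw [action_one_apply] at hw
    exact h.ne (PosRoot.ext hw)
  omega

theorem covBy_of_action_simple {a b : D.PosRoot cs} {i : ι}
    (h : D.action cs (cs.simple i) a.vec = b.vec)
    (hd : D.depth cs b.vec = D.depth cs a.vec + 1) : a ⋖ b := by
  refine ⟨lt_of_le_of_ne ⟨cs.simple i, h, ?_⟩ ?_, fun c hac hcb => ?_⟩
  · rw [cs.length_simple]; omega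
  · rintro rfl
    omega
  · have := depth_lt_depth_of_lt hac
    have := depth_lt_depth_of_lt hcb
    omega

theorem action_wordProd_drop {ω : List ι} {i : ℕ} (hi : i < ω.length) (v : V) :
    D.action cs (cs.wordProd (ω.drop i)) v =
      D.action cs (cs.simple ω[i]) (D.action cs (cs.wordProd (ω.drop (i + 1))) v) := by
  rw [List.drop_eq_getElem_cons hi, cs.wordProd_cons, action_mul_apply]

theorem IsSaturatedChain.action_eq {ω : List ι} {r : ι} {β : D.PosRoot cs}
    (h : D.IsSaturatedChain cs ω r β) : D.action cs (cs.wordProd ω) (D.α r) = β.vec := by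
  obtain ⟨c, hc, -, h0⟩ := h
  rw [← h0, hc]
  simp

theorem IsSaturatedChain.depth_eq {ω : List ι} {r : ι} {β : D.PosRoot cs}
    (h : D.IsSaturatedChain cs ω r β) : D.depth cs β.vec = ω.length := by
  refine le_antisymm ((depth_le_of_action_eq h.action_eq).trans (cs.length_wordProd_le ω)) ?_
  obtain ⟨c, -, hcov, rfl⟩ := h
  -- Induction runs upwards from the bottom `α_r` of the chain, which has the last index.
  have key (j : Fin (ω.length + 1)) : ω.length ≤ D.depth cs (c j).vec + j := by
    induction j using Fin.reverseInduction with
    | last => simp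
    | cast i ih =>
      have := depth_lt_depth_of_lt (hcov i).lt
      simp only [Fin.val_succ, Fin.val_castSucc] at ih ⊢
      omega
  simpa using key 0

theorem isSaturatedChain_of_depth_eq {ω : List ι} {r : ι} {β : D.PosRoot cs}
    (hred : cs.IsReduced (ω ++ [r])) (h : D.action cs (cs.wordProd ω) (D.α r) = β.vec)
    (hd : D.depth cs β.vec = ω.length) : D.IsSaturatedChain cs ω r β := by
  have hpos (i : ℕ) (hi : i ≤ ω.length) :
      D.action cs (cs.wordProd (ω.drop i)) (D.α r) ∈ D.posCone := by
    refine action_alpha_mem_posCone cs D ?_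
    have h1 := (hred.drop i).eq
    rw [List.drop_append_of_le_length hi, cs.wordProd_append, cs.wordProd_singleton] at h1
    have h2 := cs.length_wordProd_le (ω.drop i)
    rw [List.length_append, List.length_singleton] at h1
    unfold CoxeterSystem.IsRightDescent
    omega
  have hle (i : ℕ) : D.depth cs (D.action cs (cs.wordProd (ω.drop i)) (D.α r)) ≤
      ω.length - i :=
    (depth_le_of_action_eq rfl).trans ((cs.length_wordProd_le _).trans_eq List.length_drop)
  have hge (i : ℕ) (hi : i ≤ ω.length) : ω.length ≤
      D.depth cs (D.action cs (cs.wordProd (ω.drop i)) (D.α r)) + i := by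
    induction i with
    | zero => rw [List.drop_zero, h, hd, add_zero]
    | succ i ih =>
      have h1 := ih (by omega)
      rw [action_wordProd_drop (by omega)] at h1
      have h2 := depth_action_le (action_mem_roots (alpha_mem_roots cs D r)
        (cs.wordProd (ω.drop (i + 1)))) (cs.simple ω[i])
      rw [cs.length_simple] at h2
      omega
  refine ⟨fun i => ⟨_, ⟨cs.wordProd (ω.drop i), r, rfl⟩, hpos i (by omega)⟩, fun i => rfl,
    fun i => covBy_of_action_simple (i := ω[i]) (action_wordProd_drop i.2 _).symm ?_, ?_⟩
  · have h1 := hle i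
    have h2 := hle (i + 1)
    have h3 := hge i (by omega)
    have h4 := hge (i + 1) (by omega)
    simp only [Fin.val_succ, Fin.val_castSucc]
    omega
  · exact PosRoot.ext h

end Poset

/-! ### Reduced palindromes and prefixes -/

section Prefix

theorem wordProd_palindrome (ω : List ι) (r : ι) :
    cs.wordProd (ω ++ [r] ++ ω.reverse) =
      cs.wordProd ω * cs.simple r * (cs.wordProd ω)⁻¹ := by
  rw [cs.wordProd_append, cs.wordProd_append, cs.wordProd_singleton, cs.wordProd_reverse]

/-- If `ω r` and `ω' r'` are reduced words for the same element and `ω(α_r)` has depth equal to the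
length of `ω`, then `r = r'`. -/
theorem eq_of_wordProd_eq {ω ω' : List ι} {r r' : ι} {β : D.PosRoot cs}
    (hβ : D.action cs (cs.wordProd ω) (D.α r) = β.vec) (hd : D.depth cs β.vec = ω.length)
    (hl : ω'.length ≤ ω.length)
    (hp : cs.wordProd (ω' ++ [r']) = cs.wordProd (ω ++ [r])) : r' = r := by
  by_contra hne
  have h : D.action cs (cs.wordProd ω')⁻¹ β.vec =
      -D.action cs (cs.simple r') (D.α r) := by
    have h1 : cs.wordProd ω = cs.wordProd ω' * cs.simple r' * cs.simple r := by
      rw [cs.wordProd_append, cs.wordProd_append, cs.wordProd_singleton,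
        cs.wordProd_singleton] at hp
      rw [hp, cs.simple_mul_simple_cancel_right]
    rw [← hβ, ← action_mul_apply, h1, mul_assoc, inv_mul_cancel_left, action_mul_apply,
      action_simple_self, map_neg]
  -- Here `s_{r'}(α_r)` is positive: `α_r = α_{r'}` would contradict `B(α_{r'}, α_r) ≤ 0`.
  have h2 := depth_lt_length_of_neg_mem β.mem_roots β.mem_cone (w := (cs.wordProd ω')⁻¹) (by
    rw [h, neg_neg]
    refine action_simple_mem_posCone (alpha_mem_roots cs D r) (D.alpha_mem_posCone r) fun he => ?_
    have h3 := D.B_self r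
    rw [he] at h3
    have h4 := D.B_alpha_nonpos hne
    rw [← he] at h3 h4
    rw [D.B_self] at h3
    rw [he, D.B_self] at h4
    linarith)
  rw [cs.length_inv] at h2
  have := cs.length_wordProd_le ω'
  omega

theorem IsPosRootOf.isReduced_palindrome_iff {t : W} {β : D.PosRoot cs}
    (h : D.IsPosRootOf cs t β) {ω : List ι} {r : ι}
    (ht : cs.wordProd (ω ++ [r] ++ ω.reverse) = t) :
    cs.IsReduced (ω ++ [r] ++ ω.reverse) ↔ D.depth cs β.vec = ω.length := by
  rw [CoxeterSystem.IsReduced, ht, h.length_eq]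
  simp only [List.length_append, List.length_singleton, List.length_reverse]
  omega

theorem IsSaturatedChain.isReduced_palindrome {t : W} {ω : List ι} {r : ι} {β : D.PosRoot cs}
    (hβ : D.IsPosRootOf cs t β) (h : D.IsSaturatedChain cs ω r β) :
    cs.IsReduced (ω ++ [r] ++ ω.reverse) ∧ cs.wordProd (ω ++ [r] ++ ω.reverse) = t := by
  have ht := (wordProd_palindrome ω r).trans (hβ.eq_conj h.action_eq).symm
  exact ⟨(hβ.isReduced_palindrome_iff ht).2 h.depth_eq, ht⟩

theorem IsSaturatedChain.isReduced {t : W} {ω : List ι} {r : ι} {β : D.PosRoot cs}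
    (hβ : D.IsPosRootOf cs t β) (h : D.IsSaturatedChain cs ω r β) :
    cs.IsReduced (ω ++ [r]) := by
  simpa only [List.take_left'] using (h.isReduced_palindrome hβ).1.take (ω ++ [r]).length

theorem IsSaturatedChain.isReflectionPrefix {t : W} {ω : List ι} {r : ι} {β : D.PosRoot cs}
    (hβ : D.IsPosRootOf cs t β) (h : D.IsSaturatedChain cs ω r β) :
    cs.IsReflectionPrefix t (cs.wordProd (ω ++ [r])) := by
  have hred := (h.isReduced hβ).eq
  refine ⟨fun h1 => ?_, fun ω' r' hred' hp => ?_⟩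
  · rw [h1, cs.length_one] at hred
    simp at hred
  have hl : ω'.length = ω.length := by
    have := hred'.eq
    rw [hp, hred] at this
    simpa using this.symm
  obtain rfl := eq_of_wordProd_eq h.action_eq h.depth_eq hl.le hp
  have hω : cs.wordProd ω' = cs.wordProd ω := by
    rw [cs.wordProd_append, cs.wordProd_append] at hp
    exact mul_right_cancel hp
  have ht : cs.wordProd (ω' ++ [r'] ++ ω'.reverse) = t := by
    rw [wordProd_palindrome, hω, ← wordProd_palindrome]
    exact (h.isReduced_palindrome hβ).2
  exact ⟨(hβ.isReduced_palindrome_iff ht).2 (h.depth_eq.trans hl.symm), ht⟩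

theorem action_eq_of_isReflectionPrefix {t p : W} {β : D.PosRoot cs}
    (hβ : D.IsPosRootOf cs t β) (hp : cs.IsReflectionPrefix t p) {ω : List ι} {r : ι}
    (hred : cs.IsReduced (ω ++ [r])) (hω : cs.wordProd (ω ++ [r]) = p) :
    D.action cs (cs.wordProd ω) (D.α r) = β.vec := by
  have hpos : D.action cs (cs.wordProd ω) (D.α r) ∈ D.posCone := by
    refine action_alpha_mem_posCone cs D ?_
    have h1 := hred.eq
    rw [cs.wordProd_append, cs.wordProd_singleton, List.length_append,
      List.length_singleton] at h1
    have h2 := cs.length_wordProd_le ω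
    unfold CoxeterSystem.IsRightDescent
    omega
  let γ : D.PosRoot cs := ⟨_, ⟨cs.wordProd ω, r, rfl⟩, hpos⟩
  have hγ : D.IsPosRootOf cs t γ := by
    intro v
    rw [← (hp.2 ω r hred hω).2, wordProd_palindrome]
    exact action_conj_of_reflection (D.action_simple cs r) v
  exact congrArg PosRoot.vec (hβ.unique hγ)

end Prefix

end SimpleSystem

theorem mainTheorem7 {ι W V : Type*} [Group W] [AddCommGroup V] [Module ℝ V]
    {M : CoxeterMatrix ι} (cs : CoxeterSystem M W) (D : SimpleSystem M V)
    (t : W) (ht : cs.IsReflection t) :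
    (∃! β : D.PosRoot cs, D.IsPosRootOf cs t β) ∧
    ∀ β : D.PosRoot cs, D.IsPosRootOf cs t β →
      (∀ (ω : List ι) (r : ι), D.IsSaturatedChain cs ω r β →
        cs.IsReduced (ω ++ [r]) ∧ cs.IsReflectionPrefix t (cs.wordProd (ω ++ [r]))) ∧
      (∀ p : W, cs.IsReflectionPrefix t p →
        ∀ (ω : List ι) (r : ι), cs.IsReduced (ω ++ [r]) → cs.wordProd (ω ++ [r]) = p →
          (∀ s : ι, cs.IsRightDescent p s ↔ s = r) ∧ D.IsSaturatedChain cs ω r β) := by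
  obtain ⟨β₀, hβ₀⟩ := D.exists_isPosRootOf ht
  refine ⟨⟨β₀, hβ₀, fun γ hγ => hβ₀.unique hγ⟩, fun β hβ =>
    ⟨fun ω r h => ⟨h.isReduced hβ, h.isReflectionPrefix hβ⟩, ?_⟩⟩
  intro p hp ω r hred hω
  have hact := SimpleSystem.action_eq_of_isReflectionPrefix hβ hp hred hω
  obtain ⟨hpal, hpt⟩ := hp.2 ω r hred hω
  have hdep := (hβ.isReduced_palindrome_iff hpt).1 hpal
  have hlen := hred.eq
  rw [List.length_append, List.length_singleton, hω] at hlen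
  refine ⟨fun s => ⟨fun hs => ?_, ?_⟩, SimpleSystem.isSaturatedChain_of_depth_eq hred hact hdep⟩
  · rw [cs.isRightDescent_iff] at hs
    -- A descent `s` yields a reduced word of `p` ending in `s`, and all of these end in `r`.
    obtain ⟨ω', hred', hω'⟩ := cs.exists_isReduced (p * cs.simple s)
    refine SimpleSystem.eq_of_wordProd_eq hact hdep (ω' := ω') ?_ ?_
    · rw [← hred'.eq, ← hω']
      omega
    · rw [cs.wordProd_append, ← hω', cs.wordProd_singleton, cs.simple_mul_simple_cancel_right, hω]
  · rintro rfl
    rw [cs.isRightDescent_iff, ← hω, cs.wordProd_append, cs.wordProd_singleton,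
      cs.simple_mul_simple_cancel_right]
    have h1 := cs.length_wordProd_le ω
    have h2 := cs.length_mul_le (cs.wordProd ω) (cs.simple s)
    rw [← cs.wordProd_singleton, ← cs.wordProd_append, hω, cs.wordProd_singleton,
      cs.length_simple] at h2
    rw [← cs.wordProd_singleton, ← cs.wordProd_append, hω]
    omega
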